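/- Let $D$ be a probability distribution of data records $d=(x,y)$ with a binary outcome $y\in\{0,1\}$. The Bayes-optimal probability of a record is $p(x)=\Pr(y=1\mid x)$ and its weight is $|2p(x)-1|\in[0,1]$. Assume that the weight of a record drawn from $D$ has a probability density $f$ on $[0,1]$ that is continuous and strictly positive on $[0,1]$, and let $\epsilon$ be a real number with $0<\epsilon<\tfrac12\int_0^1 w f(w)\,dw$. Let $d_1,d_2,\dots$ with $d_i=(x_i,y_i)$ be an infinite i.i.d. sequence of records drawn from $D$, put $p_i=p(x_i)$, $w_i=|2p_i-1|$ and $W_N=(w_1,\dots,w_N)$, and let $$R_N(\epsilon)=\Big\{\theta\in\{0,1\}^N : \frac{\theta\cdot W_N}{N}\le\epsilon\Big\},\qquad q_{N,i}=\frac{|\{\theta\in R_N(\epsilon):\theta_i=1\}|}{|R_N(\epsilon)|}\quad(1\le i\le N).$$ Let $g(C)=\int_0^1 \frac{w f(w)}{1+e^{Cw}}\,dw$ for $C\in\mathbb{R}$. Then $g$ is injective and $\epsilon$ lies in its range, so that $C(\epsilon)=g^{-1}(\epsilon)$ is a well-defined real number, and almost surely, for every $i\ge 1$, $$\lim_{N\to\infty}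 q_{N,i}=\frac{1}{1+\exp(C(\epsilon)\,w_i)}.$$ -/

import Mathlib

open MeasureTheory ProbabilityTheory Filter Topology Set

noncomputable section

/-- The Bayes-optimal probability `Pr(y = 1 | x)` of a data distribution `D` of records `(x, y)`,
with the binary outcome `y = 1` encoded as `true`: the conditional distribution of `y` given `x`,
evaluated at the outcome `1`. -/
def bayesProb {X : Type*} [MeasurableSpace X] (D : Measure (X × Bool)) [IsFiniteMeasure D]
    (x : X) : ℝ :=
  (D.condKernel x).real {true}

/-- The weight `|2p - 1|` of a data record `(x, y)` with Bayes-optimal probability `p`. -/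
def recordWeight {X : Type*} [MeasurableSpace X] (D : Measure (X × Bool)) [IsFiniteMeasure D]
    (d : X × Bool) : ℝ :=
  |2 * bayesProb D d.1 - 1|

/-- The Rashomon set of flip vectors `θ ∈ {0,1}^N` with `θ · W_N / N ≤ ε`, where
`W_N` consists of the first `N` terms of the weight sequence `w` (indexed from `0`). -/
def rashomonSet (w : ℕ → ℝ) (N : ℕ) (ε : ℝ) : Set (Fin N → Fin 2) :=
  {θ | (∑ j : Fin N, ((θ j : ℕ) : ℝ) * w j) / N ≤ ε}

/-- The flip probability: the proportion of the flip vectors in the Rashomon set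
with `θ i = 1` (meaningful for `i < N`). -/
def flipProb (w : ℕ → ℝ) (N : ℕ) (ε : ℝ) (i : ℕ) : ℝ :=
  ({θ ∈ rashomonSet w N ε | ∃ h : i < N, θ ⟨i, h⟩ = 1}.ncard : ℝ) / ((rashomonSet w N ε).ncard : ℝ)

/-- The function `g(C) = ∫₀¹ w f(w) / (1 + exp(C w)) dw`. -/
def tiltedMean (f : ℝ → ℝ) (C : ℝ) : ℝ :=
  ∫ w in (0 : ℝ)..1, w * f w / (1 + Real.exp (C * w))

end

/-!
The argument compares the uniform distribution on the Rashomon set with the product measure under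
which `θ j` is Bernoulli with mean `1 / (1 + exp (C w j))`. No local limit theorem is needed,
because of a monotonicity: exchanging two coordinates shows that heavier records are flipped less
often (`flipProb_antitone_weight`). Hence the flip probability of record `i` is bounded below by
the average of the flip probabilities over the records whose weights lie in a short interval above
`w i`, and bounded above by the average over a short interval below `w i` (`tendsto_flipProb`). It
remains to find the limits of such averages, which are averages over a positive proportion of the
records and therefore robust under errors `exp (o(N))` in the count of the Rashomon set.

These averages are computed by a Gibbs conditioning estimate (`sum_mul_average_le`). With
`Z(c) = ∏ j, (1 + exp (c j))`, the exponential moment of `v · θ` under the uniform distribution on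
the Rashomon set is at most `exp (C N ε) Z(-C w + v) / |R|`. Expanding `log Z` to second order
around `-C w` (`prod_one_add_exp_add_le`) produces the mean of `v · θ` under the product measure.
The set is large enough, up to `exp (o(N))`, because a slightly larger tilt `t > C` places the mean
of `θ · w` strictly below `N ε`, and Chernoff's bound concentrates `θ · w` near that mean
(`partition_le_card_mul`). Jensen's inequality turns the exponential moment into a bound for
the mean of `v · θ`; taking `v` to be `± δ` times the indicator of an interval gives both
directions.

Randomness enters only through the strong law of large numbers, for the means
`(1/N) ∑ w j / (1 + exp (t w j))` at countably many tilts `t` and for the frequencies of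
intervals with rational endpoints.
-/

/-! ### Counting binary vectors below a level by exponential tilting -/

/-- The partition function of a product of Bernoulli laws factorizes. -/
theorem sum_exp_linear {ι : Type*} [Fintype ι] [DecidableEq ι] (c : ι → ℝ) :
    ∑ θ : ι → Fin 2, Real.exp (∑ j, c j * ((θ j : ℕ) : ℝ)) = ∏ j, (1 + Real.exp (c j)) := by
  simp_rw [Real.exp_sum]
  rw [← Fintype.piFinset_univ, ← Finset.prod_univ_sum (fun _ : ι => (Finset.univ : Finset (Fin 2)))
    (fun j k => Real.exp (c j * ((k : ℕ) : ℝ)))]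
  simp [Fin.sum_univ_two]

theorem one_add_exp_add_le (c v : ℝ) (hv : |v| ≤ 1) :
    1 + Real.exp (c + v) ≤
      (1 + Real.exp c) * Real.exp (v * (1 / (1 + Real.exp (-c))) + v ^ 2) := by
  have h1 : Real.exp v ≤ 1 + v + v ^ 2 := by
    have := (abs_le.1 (Real.abs_exp_sub_one_sub_id_le hv)).2
    linarith
  have hc := Real.exp_pos c
  have h2 : 1 / (1 + Real.exp (-c)) = Real.exp c / (1 + Real.exp c) := by
    rw [Real.exp_neg]; field_simp; ring
  have h3 := Real.add_one_le_exp (v * (1 / (1 + Real.exp (-c))) + v ^ 2)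
  calc 1 + Real.exp (c + v) = 1 + Real.exp c * Real.exp v := by rw [Real.exp_add]
    _ ≤ 1 + Real.exp c * (1 + v + v ^ 2) := by gcongr
    _ ≤ (1 + Real.exp c) * (v * (1 / (1 + Real.exp (-c))) + v ^ 2 + 1) := by
      rw [h2]
      have : (1 + Real.exp c) * (v * (Real.exp c / (1 + Real.exp c)) + v ^ 2 + 1)
        = v * Real.exp c + (1 + Real.exp c) * (v ^ 2 + 1) := by field_simp; ring
      rw [this]; nlinarith [sq_nonneg v]
    _ ≤ _ := by gcongr

/-- The second-order upper bound for the logarithm of the partition function: its gradient is the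
vector of means of the tilted Bernoulli laws, and its Hessian is bounded. -/
theorem prod_one_add_exp_add_le {ι : Type*} [Fintype ι] (c v : ι → ℝ) (hv : ∀ j, |v j| ≤ 1) :
    ∏ j, (1 + Real.exp (c j + v j)) ≤ (∏ j, (1 + Real.exp (c j))) *
      Real.exp (∑ j, v j * (1 / (1 + Real.exp (-c j))) + ∑ j, v j ^ 2) := by
  rw [← Finset.sum_add_distrib, Real.exp_sum, ← Finset.prod_mul_distrib]
  exact Finset.prod_le_prod (fun j _ => by positivity) fun j _ => one_add_exp_add_le _ _ (hv j)

/-- Chernoff's bound for the tilted product measure, before normalization: shifting the tilt by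
`s` bounds the mass of the event `s * (S - m) ≥ b`. -/
theorem sum_exp_filter_le {ι : Type*} [Fintype ι] [DecidableEq ι] (w : ι → ℝ)
    (hw : ∀ j, |w j| ≤ 1) (t s b : ℝ) (hs : |s| ≤ 1)
    (T : Finset (ι → Fin 2)) (hT : ∀ θ ∈ T, b ≤
      s * (∑ j, ((θ j : ℕ) : ℝ) * w j - ∑ j, w j * (1 / (1 + Real.exp (t * w j))))) :
    ∑ θ ∈ T, Real.exp (-t * ∑ j, ((θ j : ℕ) : ℝ) * w j) ≤
      (∏ j, (1 + Real.exp (-t * w j))) * Real.exp (s ^ 2 * Fintype.card ι - b) := by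
  set m := ∑ j, w j * (1 / (1 + Real.exp (t * w j))) with hm
  have hsw : ∀ j, |s * w j| ≤ 1 := fun j => by
    rw [abs_mul]; exact mul_le_one₀ hs (abs_nonneg _) (hw j)
  have h1 := prod_one_add_exp_add_le (fun j => -t * w j) (fun j => s * w j) hsw
  have h2 : ∑ j, (s * w j) ^ 2 ≤ s ^ 2 * Fintype.card ι := by
    calc ∑ j, (s * w j) ^ 2 ≤ ∑ _j : ι, s ^ 2 := by
          refine Finset.sum_le_sum fun j _ => ?_
          rw [mul_pow]
          exact mul_le_of_le_one_right (sq_nonneg s) ((sq_le_one_iff_abs_le_one _).2 (hw j))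
      _ = _ := by simp [mul_comm]
  have h3 : ∑ j, s * w j * (1 / (1 + Real.exp (-(-t * w j)))) = s * m := by
    rw [hm, Finset.mul_sum]
    refine Finset.sum_congr rfl fun j _ => ?_
    rw [neg_mul, neg_neg, mul_assoc]
  have h4 : ∑ θ ∈ T, Real.exp (-t * ∑ j, ((θ j : ℕ) : ℝ) * w j) ≤
      ∑ θ : ι → Fin 2, Real.exp (-b - s * m) *
        Real.exp (∑ j, (-t * w j + s * w j) * ((θ j : ℕ) : ℝ)) := by
    refine (Finset.sum_le_sum fun θ hθ => ?_).trans
      (Finset.sum_le_univ_sum_of_nonneg fun θ => by positivity)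
    rw [← Real.exp_add]
    have := hT θ hθ
    have e : ∑ j, (-t * w j + s * w j) * ((θ j : ℕ) : ℝ) =
        (-t + s) * ∑ j, ((θ j : ℕ) : ℝ) * w j := by
      rw [Finset.mul_sum]; exact Finset.sum_congr rfl fun j _ => by ring
    rw [e]; gcongr; linarith
  rw [← Finset.mul_sum, sum_exp_linear] at h4
  refine h4.trans ?_
  calc _ ≤ Real.exp (-b - s * m) * _ := mul_le_mul_of_nonneg_left h1 (Real.exp_pos _).le
    _ = (∏ j, (1 + Real.exp (-t * w j))) * Real.exp (-b - s * m + (s * m + ∑ j, (s * w j) ^ 2)) := by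
      rw [h3, Real.exp_add (-b - s * m)]; ring
    _ ≤ _ := by gcongr; linarith

/-- The lower bound for the number of vectors below the level `A`: under the tilt `t` the
sum `θ · w` is, by Chernoff's bound on both sides, within `ρ n` of its mean with probability at
least `1/2`. -/
theorem partition_le_card_mul {ι : Type*} [Fintype ι] [DecidableEq ι] (w : ι → ℝ)
    (hw : ∀ j, |w j| ≤ 1) (t ρ A : ℝ) (ht : 0 ≤ t) (hρ0 : 0 ≤ ρ) (hρ1 : ρ ≤ 1)
    (hA : ∑ j, w j * (1 / (1 + Real.exp (t * w j))) + ρ * Fintype.card ι ≤ A)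
    (hn : Real.exp (-(ρ ^ 2 * Fintype.card ι / 4)) ≤ 1 / 4)
    (R : Finset (ι → Fin 2)) (hR : ∀ θ, ∑ j, ((θ j : ℕ) : ℝ) * w j ≤ A → θ ∈ R) :
    ∏ j, (1 + Real.exp (-t * w j)) ≤ 2 * (R.card : ℝ) * Real.exp (-t *
      (∑ j, w j * (1 / (1 + Real.exp (t * w j))) - ρ * Fintype.card ι)) := by
  classical
  set m := ∑ j, w j * (1 / (1 + Real.exp (t * w j))) with hm
  set S : (ι → Fin 2) → ℝ := fun θ => ∑ j, ((θ j : ℕ) : ℝ) * w j with hS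
  set n : ℝ := (Fintype.card ι : ℝ)
  set Z := ∏ j, (1 + Real.exp (-t * w j)) with hZ
  have hZpos : 0 < Z := Finset.prod_pos fun j _ => by positivity
  have hZsum : ∑ θ : ι → Fin 2, Real.exp (-t * S θ) = Z := by
    rw [hZ, ← sum_exp_linear]
    refine Finset.sum_congr rfl fun θ _ => ?_
    rw [hS, Finset.mul_sum]
    congr 1
    exact Finset.sum_congr rfl fun j _ => by ring
  -- the optimal shift of the tilt is `± ρ / 2`
  have hs : |ρ / 2| ≤ 1 := by rw [abs_of_nonneg (by linarith)]; linarith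
  have h1 := sum_exp_filter_le w hw t (ρ / 2) (ρ ^ 2 * n / 2) hs
    (Finset.univ.filter fun θ => m + ρ * n < S θ) (fun θ hθ => by
      have := (Finset.mem_filter.1 hθ).2
      have : ρ / 2 * (ρ * n) ≤ ρ / 2 * (S θ - m) := by gcongr; linarith
      calc _ = ρ / 2 * (ρ * n) := by ring
        _ ≤ _ := this)
  have h2 := sum_exp_filter_le w hw t (-(ρ / 2)) (ρ ^ 2 * n / 2) (by rwa [abs_neg])
    (Finset.univ.filter fun θ => S θ < m - ρ * n) (fun θ hθ => by
      have := (Finset.mem_filter.1 hθ).2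
      have : ρ / 2 * (ρ * n) ≤ ρ / 2 * (m - S θ) := by gcongr; linarith
      calc _ = ρ / 2 * (ρ * n) := by ring
        _ ≤ _ := this
        _ = -(ρ / 2) * (S θ - m) := by ring)
  have e1 : (ρ / 2) ^ 2 * n - ρ ^ 2 * n / 2 = -(ρ ^ 2 * n / 4) := by ring
  have e2 : (-(ρ / 2)) ^ 2 * n - ρ ^ 2 * n / 2 = -(ρ ^ 2 * n / 4) := by ring
  change _ ≤ Z * Real.exp ((ρ / 2) ^ 2 * n - ρ ^ 2 * n / 2) at h1
  change _ ≤ Z * Real.exp ((-(ρ / 2)) ^ 2 * n - ρ ^ 2 * n / 2) at h2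
  rw [e1] at h1
  rw [e2] at h2
  have hZ4 : Z * Real.exp (-(ρ ^ 2 * n / 4)) ≤ Z * (1 / 4) := by gcongr
  have h3 : Z ≤ ∑ θ ∈ R, Real.exp (-t * (m - ρ * n)) +
      ((∑ θ ∈ Finset.univ.filter fun θ => m + ρ * n < S θ, Real.exp (-t * S θ)) +
      ∑ θ ∈ Finset.univ.filter fun θ => S θ < m - ρ * n, Real.exp (-t * S θ)) := by
    rw [← hZsum, Finset.sum_filter, Finset.sum_filter, ← Finset.sum_add_distrib,
      ← Finset.sum_filter_add_sum_filter_not Finset.univ (fun θ => θ ∈ R)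
        (fun θ => Real.exp (-t * S θ)), ← Finset.sum_filter_add_sum_filter_not Finset.univ
        (fun θ => θ ∈ R) (fun θ => _ + _), ← add_assoc]
    rw [Finset.filter_univ_mem, ← Finset.sum_add_distrib]
    refine add_le_add (Finset.sum_le_sum fun θ hθ => ?_) (Finset.sum_le_sum fun θ hθ => ?_)
    · by_cases hlow : S θ < m - ρ * n
      · rw [if_pos hlow]
        have := Real.exp_pos (-t * (m - ρ * n))
        split_ifs <;> linarith [Real.exp_pos (-t * S θ)]
      · have : Real.exp (-t * S θ) ≤ Real.exp (-t * (m - ρ * n)) :=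
          Real.exp_le_exp.2 (mul_le_mul_of_nonpos_left (not_lt.1 hlow) (by linarith))
        split_ifs <;> linarith [Real.exp_pos (-t * S θ)]
    · have hθ' : ¬ S θ ≤ A := fun h => (Finset.mem_filter.1 hθ).2 (hR θ h)
      rw [if_pos (by linarith)]
      split_ifs <;> linarith [Real.exp_pos (-t * S θ)]
  rw [Finset.sum_const, nsmul_eq_mul] at h3
  linarith

/-- Jensen's inequality for the uniform distribution on a finite set. -/
theorem exp_average_le {α : Type*} (R : Finset α) (X : α → ℝ) (hR : R.Nonempty) :
    R.card * Real.exp ((∑ a ∈ R, X a) / R.card) ≤ ∑ a ∈ R, Real.exp (X a) := by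
  have hc : (0 : ℝ) < R.card := by exact_mod_cast hR.card_pos
  set μ := (∑ a ∈ R, X a) / R.card with hμ
  have h : ∀ a ∈ R, Real.exp μ * (X a - μ + 1) ≤ Real.exp (X a) := fun a _ => by
    calc _ ≤ Real.exp μ * Real.exp (X a - μ) := by
          gcongr; exact Real.add_one_le_exp _
      _ = _ := by rw [← Real.exp_add]; congr 1; ring
  refine le_trans (le_of_eq ?_) (Finset.sum_le_sum h)
  rw [← Finset.mul_sum, Finset.sum_add_distrib, Finset.sum_sub_distrib]
  simp only [Finset.sum_const, nsmul_eq_mul]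
  rw [hμ]; field_simp; ring

/-- The Gibbs conditioning estimate. Under the uniform distribution on the vectors below the level
`A`, the mean of the linear statistic `v · θ` exceeds its mean under the tilt `C` by at most a
quadratic term in `v` and the entropy deficit. -/
theorem sum_mul_average_le {ι : Type*} [Fintype ι] [DecidableEq ι] (w v : ι → ℝ)
    (hw : ∀ j, |w j| ≤ 1) (hv : ∀ j, |v j| ≤ 1) (C t ρ A : ℝ) (hC : 0 ≤ C) (hCt : C ≤ t)
    (htC : t ≤ C + 1) (hρ0 : 0 ≤ ρ) (hρ1 : ρ ≤ 1)
    (hA : ∑ j, w j * (1 / (1 + Real.exp (t * w j))) + ρ * Fintype.card ι ≤ A)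
    (hn : Real.exp (-(ρ ^ 2 * Fintype.card ι / 4)) ≤ 1 / 4)
    (R : Finset (ι → Fin 2)) (hR : ∀ θ, θ ∈ R ↔ ∑ j, ((θ j : ℕ) : ℝ) * w j ≤ A) :
    (∑ θ ∈ R, ∑ j, v j * ((θ j : ℕ) : ℝ)) / R.card ≤
      ∑ j, v j * (1 / (1 + Real.exp (C * w j))) + ∑ j, v j ^ 2 + Real.log 2 +
      (C * (A - ∑ j, w j * (1 / (1 + Real.exp (t * w j)))) + (t - C) ^ 2 * Fintype.card ι +
        t * ρ * Fintype.card ι) := by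
  have hlow := partition_le_card_mul w hw t ρ A (hC.trans hCt) hρ0 hρ1 hA hn R
    (fun θ h => (hR θ).2 h)
  set m := ∑ j, w j * (1 / (1 + Real.exp (t * w j))) with hm
  set n : ℝ := (Fintype.card ι : ℝ) with hnn
  have hZpos : ∀ c : ι → ℝ, 0 < ∏ j, (1 + Real.exp (c j)) :=
    fun c => Finset.prod_pos fun j _ => by positivity
  have hRne : R.Nonempty := by
    rw [Finset.nonempty_iff_ne_empty]
    rintro rfl
    simp only [Finset.card_empty, Nat.cast_zero, mul_zero, zero_mul] at hlow
    exact absurd (hZpos fun j => -t * w j) (not_lt.2 hlow)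
  have hc : (0 : ℝ) < R.card := by exact_mod_cast hRne.card_pos
  have hJ := exp_average_le R (fun θ => ∑ j, v j * ((θ j : ℕ) : ℝ)) hRne
  have hup : ∑ θ ∈ R, Real.exp (∑ j, v j * ((θ j : ℕ) : ℝ)) ≤
      Real.exp (C * A) * ∏ j, (1 + Real.exp (-C * w j + v j)) := by
    rw [← sum_exp_linear, Finset.mul_sum]
    refine (Finset.sum_le_sum fun θ hθ => ?_).trans
      (Finset.sum_le_univ_sum_of_nonneg fun θ => by positivity)
    rw [← Real.exp_add]
    have h1 : C * ∑ j, ((θ j : ℕ) : ℝ) * w j ≤ C * A :=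
      mul_le_mul_of_nonneg_left ((hR θ).1 hθ) hC
    have e : ∑ j, (-C * w j + v j) * ((θ j : ℕ) : ℝ) =
        -(C * ∑ j, ((θ j : ℕ) : ℝ) * w j) + ∑ j, v j * ((θ j : ℕ) : ℝ) := by
      rw [Finset.mul_sum, ← Finset.sum_neg_distrib, ← Finset.sum_add_distrib]
      exact Finset.sum_congr rfl fun j _ => by ring
    rw [e]; gcongr; linarith
  have h1 := prod_one_add_exp_add_le (fun j => -C * w j) v hv
  -- the partition function at the tilt `C`, expanded around the tilt `t`
  have h3 : ∏ j, (1 + Real.exp (-C * w j)) ≤ (∏ j, (1 + Real.exp (-t * w j))) *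
      Real.exp ((t - C) * m + (t - C) ^ 2 * n) := by
    have hd : ∀ j, |(t - C) * w j| ≤ 1 := fun j => by
      rw [abs_mul]
      exact mul_le_one₀ (by rw [abs_of_nonneg] <;> linarith) (abs_nonneg _) (hw j)
    have := prod_one_add_exp_add_le (fun j => -t * w j) (fun j => (t - C) * w j) hd
    have e : ∀ j, -t * w j + (t - C) * w j = -C * w j := fun j => by ring
    simp only [e] at this
    refine this.trans ?_
    gcongr
    · rw [hm, Finset.mul_sum]
      refine le_of_eq (Finset.sum_congr rfl fun j _ => ?_)
      rw [neg_mul, neg_neg, mul_assoc]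
    · calc ∑ j, ((t - C) * w j) ^ 2 ≤ ∑ _j : ι, (t - C) ^ 2 := by
            refine Finset.sum_le_sum fun j _ => ?_
            rw [mul_pow]
            exact mul_le_of_le_one_right (sq_nonneg _) ((sq_le_one_iff_abs_le_one _).2 (hw j))
        _ = _ := by simp [mul_comm, hnn]
  have h4 : R.card * Real.exp ((∑ θ ∈ R, ∑ j, v j * ((θ j : ℕ) : ℝ)) / R.card) ≤
      R.card * Real.exp (∑ j, v j * (1 / (1 + Real.exp (C * w j))) + ∑ j, v j ^ 2 + Real.log 2 +
      (C * (A - m) + (t - C) ^ 2 * n + t * ρ * n)) := by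
    refine (hJ.trans hup).trans ?_
    calc _ ≤ Real.exp (C * A) * (((2 * (R.card : ℝ) * Real.exp (-t * (m - ρ * n))) *
          Real.exp ((t - C) * m + (t - C) ^ 2 * n)) *
          Real.exp (∑ j, v j * (1 / (1 + Real.exp (-(-C * w j)))) + ∑ j, v j ^ 2)) := by
          refine mul_le_mul_of_nonneg_left (h1.trans ?_) (Real.exp_pos _).le
          refine mul_le_mul_of_nonneg_right (h3.trans ?_) (Real.exp_pos _).le
          exact mul_le_mul_of_nonneg_right hlow (Real.exp_pos _).le
      _ = R.card * (Real.exp (C * A) * Real.exp (Real.log 2) * Real.exp (-t * (m - ρ * n)) *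
          Real.exp ((t - C) * m + (t - C) ^ 2 * n) *
          Real.exp (∑ j, v j * (1 / (1 + Real.exp (-(-C * w j)))) + ∑ j, v j ^ 2)) := by
          rw [Real.exp_log two_pos]; ring
      _ = _ := by
          simp only [← Real.exp_add, neg_mul, neg_neg]
          congr 2
          ring
  exact Real.exp_le_exp.1 (le_of_mul_le_mul_left h4 hc)

/-! ### Flip probabilities for a fixed sequence of weights -/

/-- The flip probability is the mean of a coordinate under the uniform distribution on the
Rashomon set. -/
theorem flipProb_eq_average (w : ℕ → ℝ) (N : ℕ) (ε : ℝ) (i : Fin N) :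
    flipProb w N ε i = (∑ θ ∈ (Set.toFinite (rashomonSet w N ε)).toFinset, ((θ i : ℕ) : ℝ)) /
      ((Set.toFinite (rashomonSet w N ε)).toFinset.card : ℝ) := by
  classical
  unfold flipProb
  rw [Set.ncard_eq_toFinset_card (rashomonSet w N ε) (Set.toFinite _)]
  congr 1
  have h1 : ∀ θ : Fin N → Fin 2, ((θ i : ℕ) : ℝ) = if θ i = 1 then 1 else 0 := fun θ => by
    generalize θ i = x
    fin_cases x <;> simp
  simp_rw [h1]
  rw [← Finset.sum_filter, Finset.sum_const, nsmul_eq_mul, mul_one,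
    ← Set.ncard_coe_finset]
  congr 2
  ext θ
  simp

/-- Exchanging two coordinates shows that a heavier record is flipped less often. -/
theorem flipProb_antitone_weight (w : ℕ → ℝ) (N : ℕ) (ε : ℝ) (i j : ℕ) (hi : i < N) (hj : j < N)
    (h : w i ≤ w j) : flipProb w N ε j ≤ flipProb w N ε i := by
  rcases eq_or_ne i j with rfl | hij
  · exact le_rfl
  refine div_le_div_of_nonneg_right (Nat.cast_le.2 ?_) (Nat.cast_nonneg _)
  set σ : Equiv.Perm (Fin N) := Equiv.swap ⟨i, hi⟩ ⟨j, hj⟩ with hσ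
  refine Set.ncard_le_ncard_of_injOn (fun θ : Fin N → Fin 2 => θ ∘ σ) ?_ ?_ (Set.toFinite _)
  · rintro θ ⟨hθ, _, hθj⟩
    have hne : (⟨i, hi⟩ : Fin N) ≠ ⟨j, hj⟩ := fun h => hij (Fin.mk.inj_iff.1 h)
    have hθ' : (∑ k : Fin N, ((θ k : ℕ) : ℝ) * w k) / N ≤ ε := hθ
    refine ⟨?_, hi, by simp [hσ, hθj]⟩
    change (∑ k : Fin N, (((θ ∘ σ) k : ℕ) : ℝ) * w k) / N ≤ ε
    refine le_trans (div_le_div_of_nonneg_right ?_ (Nat.cast_nonneg N)) hθ'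
    rw [← sub_nonneg, ← Finset.sum_sub_distrib, Fintype.sum_eq_add ⟨i, hi⟩ ⟨j, hj⟩ hne]
    · have h1 : ((θ ⟨i, hi⟩ : ℕ) : ℝ) ≤ 1 := by
        exact_mod_cast Nat.lt_succ_iff.1 (θ ⟨i, hi⟩).isLt
      simp only [Function.comp, hσ, Equiv.swap_apply_left, Equiv.swap_apply_right, hθj]
      simp only [Fin.val_one, Nat.cast_one]
      nlinarith
    · rintro k ⟨hk1, hk2⟩
      simp [hσ, Equiv.swap_apply_of_ne_of_ne hk1 hk2]
  · intro θ _ θ' _ heq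
    exact σ.surjective.injective_comp_right heq

/-- The asymptotic form of the Gibbs conditioning estimate. The tilts `t k`
approach `C` from above, so that their means `G k` stay strictly below the level `ε`. -/
theorem eventually_sum_mul_flipProb_le (w : ℕ → ℝ) (hw : ∀ j, |w j| ≤ 1) (C ε : ℝ) (hC : 0 ≤ C)
    (t G : ℕ → ℝ) (htC : ∀ k, C ≤ t k) (ht : Tendsto t atTop (𝓝 C))
    (hGε : ∀ k, G k < ε) (hG : Tendsto G atTop (𝓝 ε))
    (hlim : ∀ k, Tendsto (fun N : ℕ =>
      (∑ j ∈ Finset.range N, w j * (1 / (1 + Real.exp (t k * w j)))) / N) atTop (𝓝 (G k)))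
    (κ : ℝ) (hκ : 0 < κ) :
    ∀ᶠ N : ℕ in atTop, ∀ v : ℕ → ℝ, (∀ j, |v j| ≤ 1) →
      ∑ j ∈ Finset.range N, v j * flipProb w N ε j ≤
        ∑ j ∈ Finset.range N, v j * (1 / (1 + Real.exp (C * w j))) +
          ∑ j ∈ Finset.range N, v j ^ 2 + κ * N := by
  obtain ⟨k, hk1, hk2, hk3⟩ : ∃ k, t k ≤ C + 1 ∧ (t k - C) ^ 2 < κ / 5 ∧
      C * (ε - G k) < κ / 5 := by
    have h1 : Tendsto (fun k => (t k - C) ^ 2) atTop (𝓝 0) := by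
      simpa using (ht.sub_const C).pow 2
    have h2 : Tendsto (fun k => C * (ε - G k)) atTop (𝓝 0) := by
      simpa using (hG.const_sub ε).const_mul C
    have h3 : ∀ᶠ k in atTop, t k ≤ C + 1 :=
      (ht.eventually (gt_mem_nhds (lt_add_one C))).mono fun k hk => le_of_lt hk
    exact (h3.and ((h1.eventually (gt_mem_nhds (by positivity))).and
      (h2.eventually (gt_mem_nhds (by positivity))))).exists
  have htk : 0 ≤ t k := hC.trans (htC k)
  obtain ⟨ρ, hρ0, hρ1, hρ2, hρ3⟩ : ∃ ρ : ℝ, 0 < ρ ∧ ρ ≤ 1 ∧ G k + 2 * ρ ≤ ε ∧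
      t k * ρ ≤ κ / 5 := by
    have hpos := sub_pos.2 (hGε k)
    refine ⟨min 1 (min ((ε - G k) / 2) (κ / (5 * (t k + 1)))), by positivity, min_le_left _ _,
      ?_, ?_⟩
    · have := (min_le_right (1 : ℝ) _).trans (min_le_left ((ε - G k) / 2) (κ / (5 * (t k + 1))))
      linarith
    · have := (min_le_right (1 : ℝ) _).trans (min_le_right ((ε - G k) / 2) (κ / (5 * (t k + 1))))
      calc _ ≤ (t k + 1) * (κ / (5 * (t k + 1))) := by gcongr; linarith
        _ = κ / 5 := by field_simp
  have hcast : Tendsto (fun N : ℕ => (N : ℝ)) atTop atTop := tendsto_natCast_atTop_atTop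
  have e1 : ∀ᶠ N : ℕ in atTop, Real.exp (-(ρ ^ 2 * N / 4)) ≤ 1 / 4 := by
    have : Tendsto (fun N : ℕ => Real.exp (-(ρ ^ 2 * N / 4))) atTop (𝓝 0) :=
      Real.tendsto_exp_neg_atTop_nhds_zero.comp
        ((hcast.const_mul_atTop (by positivity)).atTop_div_const (by norm_num))
    exact (this.eventually (gt_mem_nhds (by norm_num))).mono fun N hN => le_of_lt hN
  have e2 : ∀ᶠ N : ℕ in atTop, Real.log 2 ≤ κ / 5 * N :=
    (hcast.const_mul_atTop (by positivity)).eventually_ge_atTop _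
  have e3 := (hlim k).eventually (gt_mem_nhds (show G k < G k + ρ by linarith))
  have e4 : ∀ᶠ N : ℕ in atTop, C * (ε - (∑ j ∈ Finset.range N,
      w j * (1 / (1 + Real.exp (t k * w j)))) / N) < κ / 5 :=
    (((hlim k).const_sub ε).const_mul C).eventually (gt_mem_nhds hk3)
  filter_upwards [e1, e2, e3, e4, eventually_gt_atTop 0] with N h1 h2 h3 h4 hN v hv
  have hN' : (0 : ℝ) < N := by exact_mod_cast hN
  set M := ∑ j ∈ Finset.range N, w j * (1 / (1 + Real.exp (t k * w j))) with hM
  have key := sum_mul_average_le (fun j : Fin N => w j) (fun j : Fin N => v j) (fun j => hw j)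
    (fun j => hv j) C (t k) ρ (ε * N) hC (htC k) hk1 hρ0.le hρ1 (by
      rw [Fin.sum_univ_eq_sum_range (fun j => w j * (1 / (1 + Real.exp (t k * w j)))),
        Fintype.card_fin, ← hM]
      rw [div_lt_iff₀ hN'] at h3
      nlinarith) (by rwa [Fintype.card_fin])
    (Set.toFinite (rashomonSet w N ε)).toFinset (fun θ => by
      rw [Set.Finite.mem_toFinset]
      exact div_le_iff₀ hN')
  rw [Finset.sum_comm, Finset.sum_div] at key
  simp_rw [← Finset.mul_sum, mul_div_assoc, ← flipProb_eq_average] at key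
  rw [Fin.sum_univ_eq_sum_range (fun j => w j * (1 / (1 + Real.exp (t k * w j)))),
    Fin.sum_univ_eq_sum_range (fun j => v j * (1 / (1 + Real.exp (C * w j)))),
    Fin.sum_univ_eq_sum_range (fun j => v j ^ 2),
    Fin.sum_univ_eq_sum_range (fun j => v j * flipProb w N ε j),
    Fintype.card_fin, ← hM] at key
  have h5 : C * (ε * N - M) ≤ κ / 5 * N := by
    calc C * (ε * N - M) = C * (ε - M / N) * N := by field_simp
      _ ≤ _ := by gcongr
  have h6 : (t k - C) ^ 2 * N ≤ κ / 5 * N := by gcongr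
  have h7 : t k * ρ * N ≤ κ / 5 * N := by gcongr
  have h8 : 0 < κ * N := by positivity
  linarith

theorem logistic_antitone {C : ℝ} (hC : 0 ≤ C) {x y : ℝ} (h : x ≤ y) :
    1 / (1 + Real.exp (C * y)) ≤ 1 / (1 + Real.exp (C * x)) := by
  gcongr

theorem continuous_logistic (C : ℝ) : Continuous fun x : ℝ => 1 / (1 + Real.exp (C * x)) :=
  continuous_const.div (by fun_prop) fun x => by positivity

/-- Convergence of a single flip probability for a fixed sequence of weights. By monotonicity it
lies between the averages over the records whose weights are just above and just below `w i`, and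
these averages converge as soon as such records have positive frequency. -/
theorem tendsto_flipProb (w : ℕ → ℝ) (hw : ∀ j, |w j| ≤ 1) (C ε : ℝ) (hC : 0 ≤ C)
    (t G : ℕ → ℝ) (htC : ∀ k, C ≤ t k) (ht : Tendsto t atTop (𝓝 C))
    (hGε : ∀ k, G k < ε) (hG : Tendsto G atTop (𝓝 ε))
    (hlim : ∀ k, Tendsto (fun N : ℕ =>
      (∑ j ∈ Finset.range N, w j * (1 / (1 + Real.exp (t k * w j)))) / N) atTop (𝓝 (G k)))
    (i : ℕ)
    (hright : ∀ b > w i, ∃ c > (0 : ℝ), ∀ᶠ N : ℕ in atTop,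
      c * N ≤ ∑ j ∈ Finset.range N, (Icc (w i) b).indicator 1 (w j))
    (hleft : ∀ a < w i, ∃ c > (0 : ℝ), ∀ᶠ N : ℕ in atTop,
      c * N ≤ ∑ j ∈ Finset.range N, (Icc a (w i)).indicator 1 (w j)) :
    Tendsto (fun N : ℕ => flipProb w N ε i) atTop (𝓝 (1 / (1 + Real.exp (C * w i)))) := by
  set h : ℝ → ℝ := fun x => 1 / (1 + Real.exp (C * x)) with hh
  have hcont : Continuous h := continuous_logistic C
  have habs : ∀ (s : Set ℝ) (δ x : ℝ), |δ| ≤ 1 → |δ * s.indicator 1 x| ≤ 1 := fun s δ x hδ => by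
    by_cases hx : x ∈ s <;> simp [hx, hδ]
  have hsq : ∀ (s : Set ℝ) (δ : ℝ) (N : ℕ),
      ∑ j ∈ Finset.range N, (δ * s.indicator 1 (w j)) ^ 2 ≤ δ ^ 2 * N := fun s δ N => by
    calc _ ≤ ∑ _j ∈ Finset.range N, δ ^ 2 := Finset.sum_le_sum fun j _ => by
          by_cases hx : w j ∈ s <;> simp [hx, sq_nonneg]
      _ = _ := by simp [mul_comm]
  rw [tendsto_order]
  constructor
  · intro l hl
    obtain ⟨b, hb, hlb⟩ : ∃ b, w i < b ∧ l < h b :=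
      (((hcont.tendsto (w i)).eventually (lt_mem_nhds hl)).filter_mono
        nhdsWithin_le_nhds |>.and self_mem_nhdsWithin : ∀ᶠ x in 𝓝[>] (w i), _).exists.imp
        fun b hb => ⟨hb.2, hb.1⟩
    obtain ⟨c, hc, hfreq⟩ := hright b hb
    have hgap := sub_pos.2 hlb
    -- a statistic of size `δ` has quadratic error `δ ^ 2`, negligible against the gap
    set δ := min 1 (c * (h b - l) / 4) with hδ
    have hδ0 : 0 < δ := by positivity
    have hδ1 : δ ≤ 1 := min_le_left _ _
    have hδ2 : δ ≤ c * (h b - l) / 4 := min_le_right _ _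
    filter_upwards [hfreq, eventually_sum_mul_flipProb_le w hw C ε hC t G htC ht hGε hG hlim
      (δ ^ 2) (by positivity), eventually_gt_atTop i] with N hN1 hN2 hN3
    have hN : (0 : ℝ) < N := by exact_mod_cast (Nat.zero_le i).trans_lt hN3
    have key := hN2 (fun j => -δ * (Icc (w i) b).indicator 1 (w j))
      (fun j => habs _ _ _ (by rw [abs_neg, abs_of_pos hδ0]; exact hδ1))
    have hs := hsq (Icc (w i) b) (-δ) N
    simp_rw [mul_assoc, ← Finset.mul_sum] at key
    have h1 : h b * ∑ j ∈ Finset.range N, (Icc (w i) b).indicator 1 (w j) ≤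
        ∑ j ∈ Finset.range N, (Icc (w i) b).indicator 1 (w j) * h (w j) := by
      rw [Finset.mul_sum]
      refine Finset.sum_le_sum fun j _ => ?_
      by_cases hx : w j ∈ Icc (w i) b
      · simpa [hx, hh] using logistic_antitone hC hx.2
      · simp [hx]
    have h2 : ∑ j ∈ Finset.range N, (Icc (w i) b).indicator 1 (w j) * flipProb w N ε j ≤
        flipProb w N ε i * ∑ j ∈ Finset.range N, (Icc (w i) b).indicator 1 (w j) := by
      rw [Finset.mul_sum]
      refine Finset.sum_le_sum fun j hj => ?_
      by_cases hx : w j ∈ Icc (w i) b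
      · simpa [hx] using flipProb_antitone_weight w N ε i j hN3 (Finset.mem_range.1 hj) hx.1
      · simp [hx]
    by_contra! hcon
    set n := ∑ j ∈ Finset.range N, (Icc (w i) b).indicator (1 : ℝ → ℝ) (w j)
    have hn : 0 ≤ n := le_trans (by positivity) hN1
    have h3 : flipProb w N ε i * n ≤ l * n := by gcongr
    have h4 : δ * (h b * n - l * n) ≤ δ * (2 * δ * N) := by
      have : δ * (h b * n - l * n) ≤ δ *
        (∑ j ∈ Finset.range N, (Icc (w i) b).indicator 1 (w j) * h (w j) -
         ∑ j ∈ Finset.range N, (Icc (w i) b).indicator 1 (w j) * flipProb w N ε j) := by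
        gcongr; linarith
      linarith
    have h5 := le_of_mul_le_mul_left h4 hδ0
    have h6 : (h b - l) * (c * N) ≤ (h b - l) * n := by gcongr
    have h7 : δ * N ≤ c * (h b - l) / 4 * N := by gcongr
    have h8 : 0 < c * (h b - l) * N := by positivity
    linarith
  · intro u hu
    obtain ⟨a, ha, hua⟩ : ∃ a, a < w i ∧ h a < u :=
      (((hcont.tendsto (w i)).eventually (gt_mem_nhds hu)).filter_mono
        nhdsWithin_le_nhds |>.and self_mem_nhdsWithin : ∀ᶠ x in 𝓝[<] (w i), _).exists.imp
        fun b hb => ⟨hb.2, hb.1⟩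
    obtain ⟨c, hc, hfreq⟩ := hleft a ha
    have hgap := sub_pos.2 hua
    set δ := min 1 (c * (u - h a) / 4) with hδ
    have hδ0 : 0 < δ := by positivity
    have hδ1 : δ ≤ 1 := min_le_left _ _
    have hδ2 : δ ≤ c * (u - h a) / 4 := min_le_right _ _
    filter_upwards [hfreq, eventually_sum_mul_flipProb_le w hw C ε hC t G htC ht hGε hG hlim
      (δ ^ 2) (by positivity), eventually_gt_atTop i] with N hN1 hN2 hN3
    have hN : (0 : ℝ) < N := by exact_mod_cast (Nat.zero_le i).trans_lt hN3
    have key := hN2 (fun j => δ * (Icc a (w i)).indicator 1 (w j))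
      (fun j => habs _ _ _ (by rw [abs_of_pos hδ0]; exact hδ1))
    have hs := hsq (Icc a (w i)) δ N
    simp_rw [mul_assoc, ← Finset.mul_sum] at key
    have h1 : ∑ j ∈ Finset.range N, (Icc a (w i)).indicator 1 (w j) * h (w j) ≤
        h a * ∑ j ∈ Finset.range N, (Icc a (w i)).indicator 1 (w j) := by
      rw [Finset.mul_sum]
      refine Finset.sum_le_sum fun j _ => ?_
      by_cases hx : w j ∈ Icc a (w i)
      · simpa [hx, hh] using logistic_antitone hC hx.1
      · simp [hx]
    have h2 : flipProb w N ε i * ∑ j ∈ Finset.range N, (Icc a (w i)).indicator 1 (w j) ≤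
        ∑ j ∈ Finset.range N, (Icc a (w i)).indicator 1 (w j) * flipProb w N ε j := by
      rw [Finset.mul_sum]
      refine Finset.sum_le_sum fun j hj => ?_
      by_cases hx : w j ∈ Icc a (w i)
      · simpa [hx] using flipProb_antitone_weight w N ε j i (Finset.mem_range.1 hj) hN3 hx.2
      · simp [hx]
    by_contra! hcon
    set n := ∑ j ∈ Finset.range N, (Icc a (w i)).indicator (1 : ℝ → ℝ) (w j)
    have hn : 0 ≤ n := le_trans (by positivity) hN1
    have h3 : u * n ≤ flipProb w N ε i * n := by gcongr
    have h4 : δ * (u * n - h a * n) ≤ δ * (2 * δ * N) := by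
      have : δ * (u * n - h a * n) ≤ δ *
        (∑ j ∈ Finset.range N, (Icc a (w i)).indicator 1 (w j) * flipProb w N ε j -
         ∑ j ∈ Finset.range N, (Icc a (w i)).indicator 1 (w j) * h (w j)) := by
        gcongr; linarith
      linarith
    have h5 := le_of_mul_le_mul_left h4 hδ0
    have h6 : (u - h a) * (c * N) ≤ (u - h a) * n := by gcongr
    have h7 : δ * N ≤ c * (u - h a) / 4 * N := by gcongr
    have h8 : 0 < c * (u - h a) * N := by positivity
    linarith

/-! ### The tilted mean -/

theorem continuousOn_tiltedMean_integrand {f : ℝ → ℝ} (hf : ContinuousOn f (Icc 0 1)) (C : ℝ) :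
    ContinuousOn (fun w => w * f w / (1 + Real.exp (C * w))) (Icc 0 1) :=
  (continuousOn_id.mul hf).div (by fun_prop) fun x _ => by positivity

theorem strictAnti_tiltedMean {f : ℝ → ℝ} (hf : ContinuousOn f (Icc 0 1))
    (hpos : ∀ w ∈ Icc (0 : ℝ) 1, 0 < f w) : StrictAnti (tiltedMean f) := by
  intro C C' hC
  refine intervalIntegral.integral_lt_integral_of_continuousOn_of_le_of_exists_lt one_pos
    (continuousOn_tiltedMean_integrand hf C') (continuousOn_tiltedMean_integrand hf C)
    (fun w hw => ?_) ⟨1, by simp, ?_⟩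
  · have h1 := hpos w (Ioc_subset_Icc_self hw)
    have h2 := hw.1
    gcongr
  · have h1 := hpos 1 (by simp)
    gcongr

theorem continuous_tiltedMean {f : ℝ → ℝ} (hf : ContinuousOn f (Icc 0 1))
    (hpos : ∀ w ∈ Icc (0 : ℝ) 1, 0 < f w) : Continuous (tiltedMean f) := by
  refine intervalIntegral.continuous_of_dominated_interval (bound := f) (fun C => ?_)
    (fun C => ?_) (hf.intervalIntegrable_of_Icc zero_le_one) (Eventually.of_forall fun w _ => ?_)
  · rw [uIoc_of_le zero_le_one]
    exact ((continuousOn_tiltedMean_integrand hf C).mono Ioc_subset_Icc_self).aestronglyMeasurable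
      measurableSet_Ioc
  · refine Eventually.of_forall fun w hw => ?_
    rw [uIoc_of_le zero_le_one] at hw
    have h1 := hpos w (Ioc_subset_Icc_self hw)
    have h2 := hw.1
    rw [Real.norm_of_nonneg (by positivity), div_le_iff₀ (by positivity)]
    nlinarith [hw.2, Real.exp_pos (C * w), mul_pos h1 (Real.exp_pos (C * w)),
      mul_le_mul_of_nonneg_right hw.2 h1.le]
  · exact continuous_const.div (by fun_prop) fun x => by positivity

/-- Every level between `0` and half of the mean is attained, by a positive tilt: `g 0` is half of
the mean, and `g C ≤ (∫ f) / C` for positive `C`. -/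
theorem exists_tiltedMean_eq {f : ℝ → ℝ} (hf : ContinuousOn f (Icc 0 1))
    (hpos : ∀ w ∈ Icc (0 : ℝ) 1, 0 < f w) {ε : ℝ} (hε0 : 0 < ε)
    (hε : 2 * ε < ∫ w in (0 : ℝ)..1, w * f w) : ∃ C, 0 < C ∧ tiltedMean f C = ε := by
  have h0 : ε < tiltedMean f 0 := by
    have : tiltedMean f 0 = (∫ w in (0 : ℝ)..1, w * f w) / 2 := by
      rw [← intervalIntegral.integral_div]
      unfold tiltedMean
      congr 1; ext w; norm_num
    linarith
  set M := ∫ w in (0 : ℝ)..1, f w with hM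
  have hM0 : 0 < M := intervalIntegral.intervalIntegral_pos_of_pos_on
    (hf.intervalIntegrable_of_Icc zero_le_one) (fun x hx => hpos x (Ioo_subset_Icc_self hx)) one_pos
  have hA : 0 < M / ε := by positivity
  have h1 : tiltedMean f (M / ε) ≤ ε := by
    calc tiltedMean f (M / ε) ≤ ∫ w in (0 : ℝ)..1, f w / (M / ε) := by
          refine intervalIntegral.integral_mono_on zero_le_one
            ((continuousOn_tiltedMean_integrand hf _).intervalIntegrable_of_Icc zero_le_one)
            ((hf.div_const _).intervalIntegrable_of_Icc zero_le_one) fun w hw => ?_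
          have h1 := hpos w hw
          rw [div_le_div_iff₀ (by positivity) hA]
          have := Real.add_one_le_exp (M / ε * w)
          nlinarith
      _ = ε := by
          rw [intervalIntegral.integral_div, ← hM]
          field_simp
  obtain ⟨C, hC, hCε⟩ := intermediate_value_Icc' hA.le
    (continuous_tiltedMean hf hpos).continuousOn ⟨h1, h0.le⟩
  refine ⟨C, lt_of_le_of_ne hC.1 ?_, hCε⟩
  rintro rfl
  exact h0.ne' hCε

/-! ### The law of the weights and the strong law of large numbers -/

theorem measurable_recordWeight {X : Type*} [MeasurableSpace X] (D : Measure (X × Bool))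
    [IsFiniteMeasure D] : Measurable (recordWeight D) := by
  have h : Measurable (bayesProb D) :=
    (Kernel.measurable_coe D.condKernel (measurableSet_singleton true)).ennreal_toReal
  exact (((h.comp measurable_fst).const_mul 2).sub_const 1).abs

/-- The strong law of large numbers for a function of an independent sequence with law `μ`. -/
theorem ae_tendsto_average {Ω : Type*} [MeasurableSpace Ω] (P : Measure Ω)
    (W : ℕ → Ω → ℝ) (hW : ∀ i, Measurable (W i)) (hind : iIndepFun W P) (μ : Measure ℝ)
    (hlaw : ∀ i, P.map (W i) = μ) (φ : ℝ → ℝ) (hφ : Measurable φ) (hint : Integrable φ μ) :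
    ∀ᵐ ω ∂P, Tendsto (fun N : ℕ => (∑ j ∈ Finset.range N, φ (W j ω)) / N) atTop
      (𝓝 (∫ x, φ x ∂μ)) := by
  have h := strong_law_ae_real (μ := P) (fun j ω => φ (W j ω))
    ((integrable_map_measure (by rw [hlaw]; exact hφ.aestronglyMeasurable)
      (hW 0).aemeasurable).1 (by rwa [hlaw]))
    (fun i j hij => (hind.indepFun hij).comp hφ hφ)
    (fun i => (IdentDistrib.mk (hW i).aemeasurable (hW 0).aemeasurable
      (by rw [hlaw, hlaw])).comp hφ)
  have e : ∫ x, φ x ∂μ = ∫ ω, φ (W 0 ω) ∂P := by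
    rw [← hlaw 0, integral_map (hW 0).aemeasurable hφ.aestronglyMeasurable]
  rw [e]
  exact h

theorem integral_withDensity_unitInterval {f : ℝ → ℝ} (hf : ContinuousOn f (Icc 0 1))
    (hpos : ∀ w ∈ Icc (0 : ℝ) 1, 0 < f w) (φ : ℝ → ℝ) :
    ∫ x, φ x ∂((volume.restrict (Icc (0 : ℝ) 1)).withDensity fun w => ENNReal.ofReal (f w)) =
      ∫ w in (0 : ℝ)..1, f w * φ w := by
  rw [integral_withDensity_eq_integral_toReal_smul₀
    (hf.aemeasurable measurableSet_Icc).ennreal_ofReal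
    (Eventually.of_forall fun _ => ENNReal.ofReal_lt_top),
    intervalIntegral.integral_of_le zero_le_one, ← integral_Icc_eq_integral_Ioc]
  refine setIntegral_congr_fun measurableSet_Icc fun w hw => ?_
  simp [ENNReal.toReal_ofReal (hpos w hw).le]

theorem withDensity_Icc_pos {f : ℝ → ℝ} (hf : ContinuousOn f (Icc 0 1))
    (hpos : ∀ w ∈ Icc (0 : ℝ) 1, 0 < f w) {a b : ℝ} (ha : 0 ≤ a) (hab : a < b) (hb : b ≤ 1) :
    0 < ((volume.restrict (Icc (0 : ℝ) 1)).withDensity fun w => ENNReal.ofReal (f w))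
      (Icc a b) := by
  rw [pos_iff_ne_zero]
  intro h0
  have hac := withDensity_absolutelyContinuous' (μ := volume.restrict (Icc (0 : ℝ) 1))
    (hf.aemeasurable measurableSet_Icc).ennreal_ofReal
    ((ae_restrict_mem measurableSet_Icc).mono fun w hw => by simpa using hpos w hw)
  have h := hac h0
  rw [Measure.restrict_apply measurableSet_Icc,
    inter_eq_self_of_subset_left (Icc_subset_Icc ha hb), Real.volume_Icc] at h
  exact (ENNReal.ofReal_pos.2 (sub_pos.2 hab)).ne' h

/-- A set that contains an interval visited with positive limiting frequency is itself visited
with positive frequency. -/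
theorem exists_frequency_lower_bound (w : ℕ → ℝ) {s s' : Set ℝ} (hs : s ⊆ s') {l : ℝ} (hl : 0 < l)
    (h : Tendsto (fun N : ℕ => (∑ j ∈ Finset.range N, s.indicator (1 : ℝ → ℝ) (w j)) / N) atTop
      (𝓝 l)) :
    ∃ c > (0 : ℝ), ∀ᶠ N : ℕ in atTop,
      c * N ≤ ∑ j ∈ Finset.range N, s'.indicator (1 : ℝ → ℝ) (w j) := by
  refine ⟨l / 2, by positivity, ?_⟩
  filter_upwards [h.eventually (lt_mem_nhds (half_lt_self hl)), eventually_gt_atTop 0] with N h1 hN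
  have hN' : (0 : ℝ) < N := by exact_mod_cast hN
  rw [lt_div_iff₀ hN'] at h1
  exact h1.le.trans (Finset.sum_le_sum fun j _ =>
    indicator_le_indicator_of_subset hs (fun _ => zero_le_one) _)

/-! ### The limit of the flip probabilities -/

/-- The almost sure convergence of the flip probabilities for independent weights. -/
theorem ae_tendsto_flipProb {f : ℝ → ℝ} (hf : ContinuousOn f (Icc 0 1))
    (hpos : ∀ w ∈ Icc (0 : ℝ) 1, 0 < f w) {Ω : Type*} [MeasurableSpace Ω] (P : Measure Ω)
    [IsProbabilityMeasure P] (W : ℕ → Ω → ℝ) (hW : ∀ i, Measurable (W i)) (hind : iIndepFun W P)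
    (hlaw : ∀ i, P.map (W i) =
      (volume.restrict (Icc (0 : ℝ) 1)).withDensity fun w => ENNReal.ofReal (f w))
    {C ε : ℝ} (hC : 0 ≤ C) (hCε : tiltedMean f C = ε) :
    ∀ᵐ ω ∂P, ∀ i, Tendsto (fun N : ℕ => flipProb (fun j => W j ω) N ε i) atTop
      (𝓝 (1 / (1 + Real.exp (C * W i ω)))) := by
  set μ := (volume.restrict (Icc (0 : ℝ) 1)).withDensity fun w => ENNReal.ofReal (f w) with hμ
  have : IsProbabilityMeasure μ := by
    rw [← hlaw 0]; exact Measure.isProbabilityMeasure_map (hW 0).aemeasurable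
  have hsupp : ∀ᵐ x ∂μ, x ∈ Ioo (0 : ℝ) 1 := by
    refine (withDensity_absolutelyContinuous _ _).ae_le ?_
    rw [← restrict_Ioo_eq_restrict_Icc]
    exact ae_restrict_mem measurableSet_Ioo
  have hmem : ∀ᵐ ω ∂P, ∀ j, W j ω ∈ Ioo (0 : ℝ) 1 :=
    ae_all_iff.2 fun j => ae_of_ae_map (hW j).aemeasurable (by rw [hlaw]; exact hsupp)
  have hfreq : ∀ᵐ ω ∂P, ∀ a b : ℚ, Tendsto (fun N : ℕ =>
      (∑ j ∈ Finset.range N, (Icc (a : ℝ) b).indicator (1 : ℝ → ℝ) (W j ω)) / N) atTop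
      (𝓝 (μ.real (Icc (a : ℝ) b))) := by
    refine ae_all_iff.2 fun a => ae_all_iff.2 fun b => ?_
    rw [← integral_indicator_one measurableSet_Icc]
    exact ae_tendsto_average P W hW hind μ hlaw _ (measurable_one.indicator measurableSet_Icc)
      ((integrable_const (1 : ℝ)).indicator measurableSet_Icc)
  -- the tilts along which the partition function is controlled
  set t : ℕ → ℝ := fun k => C + 1 / ((k : ℝ) + 1) with ht
  have htC : ∀ k, C < t k := fun k => by
    have : (0 : ℝ) < 1 / ((k : ℝ) + 1) := by positivity
    simp only [ht]; linarith
  have htlim : Tendsto t atTop (𝓝 C) := by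
    simpa only [add_zero] using (tendsto_one_div_add_atTop_nhds_zero_nat (𝕜 := ℝ)).const_add C
  have hmean : ∀ᵐ ω ∂P, ∀ k, Tendsto (fun N : ℕ => (∑ j ∈ Finset.range N,
      W j ω * (1 / (1 + Real.exp (t k * W j ω)))) / N) atTop (𝓝 (tiltedMean f (t k))) := by
    refine ae_all_iff.2 fun k => ?_
    have hcont : Continuous fun x : ℝ => x * (1 / (1 + Real.exp (t k * x))) :=
      continuous_id.mul (continuous_logistic (t k))
    have e : tiltedMean f (t k) = ∫ x, x * (1 / (1 + Real.exp (t k * x))) ∂μ := by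
      rw [hμ, integral_withDensity_unitInterval hf hpos]
      unfold tiltedMean
      congr 1; ext w; ring
    rw [e]
    refine ae_tendsto_average P W hW hind μ hlaw _ hcont.measurable
      (Integrable.of_bound hcont.aestronglyMeasurable 1 ?_)
    filter_upwards [hsupp] with x hx
    have h0 := hx.1
    rw [Real.norm_of_nonneg (by positivity), mul_one_div, div_le_one (by positivity)]
    linarith [hx.2, Real.exp_pos (t k * x)]
  filter_upwards [hmem, hfreq, hmean] with ω h1 h2 h3 i
  have hposfreq : ∀ a b : ℚ, (0 : ℝ) ≤ a → (a : ℝ) < b → (b : ℝ) ≤ 1 →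
      0 < μ.real (Icc (a : ℝ) b) := fun a b ha hab hb =>
    ENNReal.toReal_pos (withDensity_Icc_pos hf hpos ha hab hb).ne' (measure_ne_top _ _)
  refine tendsto_flipProb (fun j => W j ω) (fun j => ?_) C ε hC t (fun k => tiltedMean f (t k))
    (fun k => (htC k).le) htlim (fun k => ?_) ?_ h3 i (fun b hb => ?_) (fun a ha => ?_)
  · rw [abs_of_pos (h1 j).1]; exact (h1 j).2.le
  · rw [← hCε]; exact strictAnti_tiltedMean hf hpos (htC k)
  · rw [← hCε]; exact ((continuous_tiltedMean hf hpos).tendsto C).comp htlim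
  · obtain ⟨p, hp1, hp2⟩ := exists_rat_btwn (lt_min hb (h1 i).2)
    obtain ⟨q, hq1, hq2⟩ := exists_rat_btwn hp2
    exact exists_frequency_lower_bound _ (Icc_subset_Icc hp1.le (hq2.le.trans (min_le_left _ _)))
      (hposfreq p q ((h1 i).1.le.trans hp1.le) hq1 (hq2.le.trans (min_le_right _ _))) (h2 p q)
  · obtain ⟨p, hp1, hp2⟩ := exists_rat_btwn (max_lt ha (h1 i).1)
    obtain ⟨q, hq1, hq2⟩ := exists_rat_btwn hp2
    exact exists_frequency_lower_bound _ (Icc_subset_Icc ((le_max_left _ _).trans hp1.le) hq2.le)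
      (hposfreq p q ((le_max_right _ _).trans hp1.le) hq1 (hq2.le.trans (h1 i).2.le)) (h2 p q)

theorem mainTheorem1 {X : Type*} [MeasurableSpace X]
    -- the distribution `D` of a data record `(x, y)`
    (D : Measure (X × Bool)) [IsProbabilityMeasure D]
    -- the weight of a record has a density `f`, continuous and positive on `[0,1]`
    (f : ℝ → ℝ) (hf_cont : ContinuousOn f (Icc 0 1)) (hf_pos : ∀ w ∈ Icc (0 : ℝ) 1, 0 < f w)
    (hf_density : D.map (recordWeight D) =
      (volume.restrict (Icc (0 : ℝ) 1)).withDensity (fun w => ENNReal.ofReal (f w)))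
    -- the error tolerance is positive and less than half of the mean weight
    (ε : ℝ) (hε_pos : 0 < ε) (hε : 2 * ε < ∫ w in (0 : ℝ)..1, w * f w)
    -- an infinite i.i.d. sequence of data records drawn from `D`
    {Ω : Type*} [MeasurableSpace Ω] (P : Measure Ω) [IsProbabilityMeasure P]
    (d : ℕ → Ω → X × Bool) (hd_meas : ∀ i, Measurable (d i)) (hd_indep : iIndepFun d P)
    (hd_law : ∀ i, P.map (d i) = D) :
    Function.Injective (tiltedMean f) ∧
    ∃ C : ℝ, tiltedMean f C = ε ∧
      ∀ᵐ ω ∂P, ∀ i : ℕ,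
        Tendsto (fun N : ℕ => flipProb (fun j => recordWeight D (d j ω)) N ε i) atTop
          (𝓝 (1 / (1 + Real.exp (C * recordWeight D (d i ω))))) := by
  obtain ⟨C, hC, hCε⟩ := exists_tiltedMean_eq hf_cont hf_pos hε_pos hε
  refine ⟨(strictAnti_tiltedMean hf_cont hf_pos).injective, C, hCε, ?_⟩
  have hw := measurable_recordWeight D
  refine ae_tendsto_flipProb hf_cont hf_pos P (fun j ω => recordWeight D (d j ω))
    (fun j => hw.comp (hd_meas j)) (hd_indep.comp _ fun _ => hw) (fun j => ?_) hC.le hCε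
  have h := Measure.map_map (μ := P) hw (hd_meas j)
  rw [hd_law j, hf_density] at h
  exact h.symm
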